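/- Let $n\ge 0$ and let $(K,R)$ be one of the following: $K$ a field of characteristic zero and $R=K[X_1,\dots,X_n]$; $K$ a field of characteristic zero and $R=K[[X_1,\dots,X_n]]$; or $K=\mathbb{C}$ and $R=\mathbb{C}\{z_1,\dots,z_n\}$, the ring of power series that converge absolutely on some polydisc of positive radius around the origin. Let $D\subseteq \operatorname{End}_K(R)$ be the ring of all $K$-linear differential operators of finite order on $R$ (in the sense of Grothendieck: $P$ has order $\le 0$ if it commutes with all multiplications by elements of $R$, and order $\le m+1$ if $[P,a]$ has order $\le m$ for every $a\in R$), and regard $R$ as a subring of $D$ acting by multiplication. Let $\partial_i$ denote the partial derivative with respect to the $i$-th variable and put $\partial^\alpha=\partial_1^{\alpha_1}\cdots\partial_n^{\alpha_n}$ for $\alpha\in\mathbb{N}^n$. Then: 1. $D$ is free as a right $R$-module. More precisely, the operators $\partial^\alpha$, $\alpha\in\mathbb{N}^n$, lie in $D$ and form a basis of $D$ as a right $R$-module: every $s\in D$ has a unique expression as a finite sum $s=\sum_{\alpha}\partial^\alpha\psi_\alpha$ with $\psi_\alpha\in R$. 2. Every injective left $D$-module is injective when it is regarded as an $R$-module by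 restriction of scalars along $R\subseteq D$. -/

import Mathlib

universe u v

/-- `IsDiffOp K R m P`: the `K`-linear endomorphism `P` of the commutative `K`-algebra `R` is a
`K`-linear differential operator of order at most `m`, in the sense of Grothendieck: operators of
order `≤ 0` commute with all multiplications by elements of `R`, and `P` has order `≤ m + 1` when
the commutator of `P` with every multiplication operator has order `≤ m`. -/
def IsDiffOp (K R : Type*) [CommRing K] [CommRing R] [Algebra K R] :
    ℕ → Module.End K R → Prop
  | 0, P => ∀ a : R, P * LinearMap.mulLeft K a - LinearMap.mulLeft K a * P = 0
  | m + 1, P => ∀ a : R, IsDiffOp K R m (P * LinearMap.mulLeft K a - LinearMap.mulLeft K a * P)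

namespace IsDiffOp

variable {K R : Type*} [CommRing K] [CommRing R] [Algebra K R]

theorem zero (m : ℕ) : IsDiffOp K R m 0 := by
  induction m with
  | zero => intro a; simp
  | succ m ih => intro a; simpa using ih

theorem add {m : ℕ} : ∀ {P Q : Module.End K R}, IsDiffOp K R m P → IsDiffOp K R m Q →
    IsDiffOp K R m (P + Q) := by
  induction m with
  | zero =>
    intro P Q hP hQ a
    have h := congrArg₂ (· + ·) (hP a) (hQ a)
    simp only [add_zero] at h
    rw [← h]; noncomm_ring
  | succ m ih =>
    intro P Q hP hQ a
    have h := ih (hP a) (hQ a)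
    have e : (P + Q) * LinearMap.mulLeft K a - LinearMap.mulLeft K a * (P + Q) =
      (P * LinearMap.mulLeft K a - LinearMap.mulLeft K a * P) +
      (Q * LinearMap.mulLeft K a - LinearMap.mulLeft K a * Q) := by noncomm_ring
    rw [e]; exact h

theorem succ {m : ℕ} : ∀ {P : Module.End K R}, IsDiffOp K R m P → IsDiffOp K R (m + 1) P := by
  induction m with
  | zero => intro P hP a; rw [hP a]; exact zero 0
  | succ m ih => intro P hP a; exact ih (hP a)

theorem mono {m l : ℕ} (h : m ≤ l) {P : Module.End K R} (hP : IsDiffOp K R m P) :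
    IsDiffOp K R l P := by
  induction h with
  | refl => exact hP
  | step _ ih => exact succ ih

theorem mul_aux (N : ℕ) : ∀ {m l : ℕ} {P Q : Module.End K R}, m + l = N → IsDiffOp K R m P →
    IsDiffOp K R l Q → IsDiffOp K R N (P * Q) := by
  have e : ∀ (P Q A : Module.End K R), P * Q * A - A * (P * Q) =
      P * (Q * A - A * Q) + (P * A - A * P) * Q := by
    intro P Q A
    rw [mul_sub, sub_mul, mul_assoc, mul_assoc, mul_assoc, sub_add_sub_cancel]
  induction N with
  | zero =>
    intro m l P Q h hP hQ a
    obtain ⟨rfl, rfl⟩ : m = 0 ∧ l = 0 := by omega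
    rw [e, hP a, hQ a]; simp
  | succ N ih =>
    intro m l P Q h hP hQ a
    rw [e]
    refine add ?_ ?_
    · cases l with
      | zero => rw [hQ a, mul_zero]; exact zero N
      | succ l => exact ih (by omega) hP (hQ a)
    · cases m with
      | zero => rw [hP a, zero_mul]; exact zero N
      | succ m => exact ih (by omega) (hP a) hQ

theorem mul {m l : ℕ} {P Q : Module.End K R} (hP : IsDiffOp K R m P) (hQ : IsDiffOp K R l Q) :
    IsDiffOp K R (m + l) (P * Q) :=
  mul_aux (m + l) rfl hP hQ

theorem mulLeft (r : R) : IsDiffOp K R 0 (LinearMap.mulLeft K r) := by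
  intro a
  ext x
  simp [mul_left_comm]

end IsDiffOp

/-- The `K`-algebra of `K`-linear differential operators on `R` (of arbitrary finite order), as a
subalgebra of the `K`-linear endomorphisms of `R`. -/
def diffOpSubalgebra (K R : Type*) [CommRing K] [CommRing R] [Algebra K R] :
    Subalgebra K (Module.End K R) where
  carrier := {P | ∃ m, IsDiffOp K R m P}
  add_mem' := by
    rintro P Q ⟨m, hP⟩ ⟨l, hQ⟩
    exact ⟨max m l, (hP.mono (le_max_left _ _)).add (hQ.mono (le_max_right _ _))⟩
  mul_mem' := by
    rintro P Q ⟨m, hP⟩ ⟨l, hQ⟩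
    exact ⟨m + l, hP.mul hQ⟩
  algebraMap_mem' := by
    intro c
    refine ⟨0, ?_⟩
    have h := IsDiffOp.mulLeft (K := K) (algebraMap K R c)
    convert h using 1
    ext x
    simp [Algebra.smul_def]

/-- The ring `D` of `K`-linear differential operators on `R`. -/
def DiffOp (K R : Type*) [CommRing K] [CommRing R] [Algebra K R] : Type _ :=
  diffOpSubalgebra K R

namespace DiffOp

variable (K R : Type*) [CommRing K] [CommRing R] [Algebra K R]

noncomputable instance : Ring (DiffOp K R) :=
  inferInstanceAs (Ring (diffOpSubalgebra K R))

/-- The underlying endomorphism of a differential operator. -/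
def toEnd : DiffOp K R →+* Module.End K R :=
  (diffOpSubalgebra K R).val.toRingHom

/-- The inclusion `R → D`, sending `r` to multiplication by `r`. -/
def ofRing : R →+* DiffOp K R where
  toFun r := ⟨LinearMap.mulLeft K r, 0, IsDiffOp.mulLeft r⟩
  map_one' := Subtype.ext (LinearMap.ext fun x => one_mul x)
  map_mul' r s := Subtype.ext (LinearMap.ext fun x => mul_assoc r s x)
  map_zero' := Subtype.ext (LinearMap.ext fun x => zero_mul x)
  map_add' r s := Subtype.ext (LinearMap.ext fun x => add_mul r s x)

/-- `D` as a right `R`-module: `P · r = P ∘ (multiplication by r)`. -/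
noncomputable instance : Module Rᵐᵒᵖ (DiffOp K R) :=
  Module.compHom (DiffOp K R) (ofRing K R).op

theorem op_smul_eq_mul (r : R) (P : DiffOp K R) :
    MulOpposite.op r • P = P * ofRing K R r := rfl

theorem toEnd_ofRing (r x : R) : toEnd K R (ofRing K R r) x = r * x := rfl

end DiffOp

/-- The monomial `∂₁^α₁ ⋯ ∂ₙ^αₙ` in `K`-linear derivations `∂₁, …, ∂ₙ` of `A`, as a `K`-linear
endomorphism of `A`. -/
def derivMonomial {K A : Type*} [CommRing K] [CommRing A] [Algebra K A] {n : ℕ}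
    (d : Fin n → Derivation K A A) (α : Fin n →₀ ℕ) : Module.End K A :=
  (List.ofFn fun i => ((d i : A →ₗ[K] A) : Module.End K A) ^ α i).prod

/-- A power series over `ℂ` in `n` variables is convergent if it converges absolutely on some
polydisc of positive radius around the origin. -/
def IsConvergentSeries {n : ℕ} (f : MvPowerSeries (Fin n) ℂ) : Prop :=
  ∃ r : ℝ, 0 < r ∧ Summable fun α : Fin n →₀ ℕ => ‖MvPowerSeries.coeff α f‖ * r ^ α.degree

namespace IsConvergentSeries

variable {n : ℕ}

theorem mono_radius {f : MvPowerSeries (Fin n) ℂ} {r s : ℝ} (hs : 0 < s) (h : s ≤ r)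
    (hf : Summable fun α : Fin n →₀ ℕ => ‖MvPowerSeries.coeff α f‖ * r ^ α.degree) :
    Summable fun α : Fin n →₀ ℕ => ‖MvPowerSeries.coeff α f‖ * s ^ α.degree := by
  refine Summable.of_nonneg_of_le (fun α => by positivity) (fun α => ?_) hf
  gcongr

theorem add {f g : MvPowerSeries (Fin n) ℂ} (hf : IsConvergentSeries f)
    (hg : IsConvergentSeries g) : IsConvergentSeries (f + g) := by
  obtain ⟨r, hr, hf⟩ := hf
  obtain ⟨s, hs, hg⟩ := hg
  have ht : 0 < min r s := lt_min hr hs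
  refine ⟨min r s, ht, ?_⟩
  refine Summable.of_nonneg_of_le (fun α => by positivity) (fun α => ?_)
    ((mono_radius ht (min_le_left _ _) hf).add (mono_radius ht (min_le_right _ _) hg))
  rw [← add_mul, map_add]
  gcongr
  exact norm_add_le _ _

theorem mul {f g : MvPowerSeries (Fin n) ℂ} (hf : IsConvergentSeries f)
    (hg : IsConvergentSeries g) : IsConvergentSeries (f * g) := by
  obtain ⟨r, hr, hf⟩ := hf
  obtain ⟨s, hs, hg⟩ := hg
  obtain ⟨t, ht, htr, hts⟩ : ∃ t, 0 < t ∧ t ≤ r ∧ t ≤ s :=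
    ⟨min r s, lt_min hr hs, min_le_left r s, min_le_right r s⟩
  have h1 := mono_radius ht htr hf
  have h2 := mono_radius ht hts hg
  refine ⟨t, ht, ?_⟩
  have hn : ∀ (k : MvPowerSeries (Fin n) ℂ) (α : Fin n →₀ ℕ),
      0 ≤ ‖MvPowerSeries.coeff α k‖ * t ^ α.degree :=
    fun k α => mul_nonneg (norm_nonneg _) (pow_nonneg ht.le _)
  have h := summable_sum_mul_antidiagonal_of_summable_mul
    (Summable.mul_of_nonneg h1 h2 (hn f) (hn g))
  refine Summable.of_nonneg_of_le (hn (f * g)) (fun α => ?_) h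
  have hle : ‖MvPowerSeries.coeff α (f * g)‖ ≤ ∑ p ∈ Finset.HasAntidiagonal.antidiagonal α,
      ‖MvPowerSeries.coeff p.1 f * MvPowerSeries.coeff p.2 g‖ := by
    rw [MvPowerSeries.coeff_mul]
    exact norm_sum_le _ _
  refine (mul_le_mul_of_nonneg_right hle (pow_nonneg ht.le _)).trans ?_
  rw [Finset.sum_mul]
  refine Finset.sum_le_sum fun p hp => ?_
  have hd : α.degree = p.1.degree + p.2.degree := by
    rw [← Finset.HasAntidiagonal.mem_antidiagonal.mp hp, map_add]
  rw [hd, pow_add, norm_mul]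
  exact le_of_eq (mul_mul_mul_comm _ _ _ _)

theorem const (c : ℂ) : IsConvergentSeries (MvPowerSeries.C c : MvPowerSeries (Fin n) ℂ) := by
  classical
  refine ⟨1, one_pos, ?_⟩
  refine summable_of_ne_finset_zero (s := {0}) fun α hα => ?_
  rw [MvPowerSeries.coeff_C, if_neg (by simpa using hα)]
  simp

end IsConvergentSeries

/-- The ring `ℂ{z₁, …, zₙ}` of convergent power series, as a `ℂ`-subalgebra of
`ℂ[[z₁, …, zₙ]]`. -/
def convergentPowerSeries (n : ℕ) : Subalgebra ℂ (MvPowerSeries (Fin n) ℂ) where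
  carrier := {f | IsConvergentSeries f}
  add_mem' := IsConvergentSeries.add
  mul_mem' := IsConvergentSeries.mul
  algebraMap_mem' := IsConvergentSeries.const

/-!
The symbol map `∑ ψ_α ξ^α ↦ ∑ ∂^α ψ_α` turns `∂/∂ξᵢ` into the commutator with the coordinate `xᵢ`.
It is injective: a nonzero symbol in the kernel could be differentiated down to a nonzero constant
in the kernel, but a constant symbol gives a multiplication operator. It is surjective by induction
on the order of an operator `P`: the symbols `pᵢ` of the commutators `[P, xᵢ]` satisfy
`∂pⱼ/∂ξᵢ = ∂pᵢ/∂ξⱼ`, so in characteristic zero the polynomial Poincaré lemma gives a symbol `q` with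
`∂q/∂ξᵢ = pᵢ`. The difference of `P` and the operator of `q` commutes with every `xᵢ`, hence is a
multiplication operator, because a derivation is determined by its values at the `xᵢ`. For power
series this last fact holds since a derivation killing the `xᵢ` maps everything into `⋂ₖ 𝔪ᵏ = 0`,
where `𝔪 = (x₁, …, xₙ)`.

Being free, `D` is flat as a right `R`-module, so `D ⊗[R] -` is an exact left adjoint of the
restriction of scalars, which therefore preserves injective modules.
-/

section Polynomial

open MvPolynomial

theorem coeff_sum_X_mul_pderiv {σ A : Type*} [Fintype σ] [CommSemiring A] (p : MvPolynomial σ A)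
    (α : σ →₀ ℕ) : coeff α (∑ i, X i * pderiv i p) = α.degree * coeff α p := by
  classical
  induction p using MvPolynomial.induction_on' with
  | add p q hp hq => simp only [map_add, mul_add, Finset.sum_add_distrib, coeff_add, hp, hq]
  | monomial β a =>
    rw [(isHomogeneous_monomial a rfl).sum_X_mul_pderiv, coeff_smul, coeff_monomial, nsmul_eq_mul]
    split_ifs with h
    · rw [h]
    · simp only [mul_zero]

variable {σ A : Type*}

theorem eq_C_of_forall_pderiv_eq_zero [Finite σ] [CommSemiring A] [IsAddTorsionFree A]
    {p : MvPolynomial σ A} (hp : ∀ i, pderiv i p = 0) : p = C (coeff 0 p) := by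
  classical
  cases nonempty_fintype σ
  ext α
  rw [coeff_C]
  split_ifs with hα
  · rw [hα]
  · have h : α.degree * coeff α p = 0 := by
      simp only [← coeff_sum_X_mul_pderiv, hp, mul_zero, Finset.sum_const_zero, coeff_zero]
    rw [← nsmul_eq_mul] at h
    exact (nsmul_eq_zero_iff_right ((Finsupp.degree_eq_zero_iff α).not.mpr (Ne.symm hα))).mp h

theorem eq_zero_of_mem_of_pderiv_mem [Finite σ] [CommSemiring A] [IsAddTorsionFree A]
    {S : Set (MvPolynomial σ A)} (hS : ∀ p ∈ S, ∀ i, pderiv i p ∈ S)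
    (hC : ∀ a, C a ∈ S → a = 0) {p : MvPolynomial σ A} (hp : p ∈ S) : p = 0 := by
  suffices h : ∀ (m : ℕ), ∀ p ∈ S, (∀ α : σ →₀ ℕ, m ≤ α.degree → coeff α p = 0) → p = 0 from
    h (p.totalDegree + 1) p hp fun α hα => coeff_eq_zero_of_totalDegree_lt hα
  intro m
  induction m with
  | zero => exact fun p _ h => MvPolynomial.ext _ _ fun α => h α α.degree.zero_le
  | succ m ih =>
    intro p hp hdeg
    have hpd : ∀ i, pderiv i p = 0 := fun i => ih _ (hS p hp i) fun α hα => by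
      rw [coeff_pderiv, hdeg _ (by simpa using hα), zero_mul]
    have hconst := eq_C_of_forall_pderiv_eq_zero hpd
    rw [hconst] at hp ⊢
    rw [hC _ hp, C_0]

theorem pderiv_pderiv_comm [CommSemiring A] (i j : σ) (p : MvPolynomial σ A) :
    pderiv i (pderiv j p) = pderiv j (pderiv i p) := by
  ext α
  by_cases hij : i = j
  · rw [hij]
  · simp only [coeff_pderiv, Finsupp.add_apply, Finsupp.single_eq_of_ne hij,
      Finsupp.single_eq_of_ne (Ne.symm hij), add_zero]
    rw [add_right_comm, mul_right_comm]

theorem pderiv_sum_X_mul [Fintype σ] [CommSemiring A] (j : σ) (f : σ → MvPolynomial σ A) :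
    pderiv j (∑ i, X i * f i) = f j + ∑ i, X i * pderiv j (f i) := by
  classical
  simp [Derivation.leibniz, pderiv_X, Finset.sum_add_distrib, Pi.single_apply, add_comm]

theorem eq_of_add_sum_X_mul_pderiv_eq [Fintype σ] [CommSemiring A] [IsAddTorsionFree A]
    {p q : MvPolynomial σ A}
    (h : p + ∑ i, X i * pderiv i p = q + ∑ i, X i * pderiv i q) : p = q := by
  ext α
  have hα : (α.degree + 1) • coeff α p = (α.degree + 1) • coeff α q := by
    simpa only [coeff_add, coeff_sum_X_mul_pderiv, ← nsmul_eq_mul, ← succ_nsmul'] using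
      congrArg (coeff α) h
  exact nsmul_right_injective α.degree.succ_ne_zero hα

theorem exists_sum_X_mul_pderiv_eq [Fintype σ] [CommRing A] [Algebra ℚ A]
    {q : MvPolynomial σ A} (hq : coeff 0 q = 0) :
    ∃ p, ∑ i, X i * pderiv i p = q := by
  classical
  refine ⟨∑ α ∈ q.support, monomial α ((α.degree : ℚ)⁻¹ • coeff α q), ?_⟩
  ext α
  have hcoeff : coeff α (∑ α ∈ q.support, monomial α ((α.degree : ℚ)⁻¹ • coeff α q)) =
      (α.degree : ℚ)⁻¹ • coeff α q := by
    simp +contextual [coeff_sum, coeff_monomial, eq_comm]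
  rw [coeff_sum_X_mul_pderiv, hcoeff, ← nsmul_eq_mul, ← Nat.cast_smul_eq_nsmul ℚ, smul_smul]
  by_cases hα : α = 0
  · rw [hα, hq, smul_zero]
  · rw [mul_inv_cancel₀, one_smul]
    exact Nat.cast_ne_zero.mpr ((Finsupp.degree_eq_zero_iff α).not.mpr hα)

theorem exists_forall_pderiv_eq [Finite σ] [CommRing A] [Algebra ℚ A] {p : σ → MvPolynomial σ A}
    (h : ∀ i j, pderiv i (p j) = pderiv j (p i)) : ∃ q, ∀ i, pderiv i q = p i := by
  cases nonempty_fintype σ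
  have : IsAddTorsionFree A := .of_module_rat A
  obtain ⟨q, hq⟩ := exists_sum_X_mul_pderiv_eq (q := ∑ i, X i * p i) (by
    simp [← constantCoeff_eq])
  refine ⟨q, fun j => eq_of_add_sum_X_mul_pderiv_eq ?_⟩
  calc pderiv j q + ∑ i, X i * pderiv i (pderiv j q)
    _ = pderiv j (∑ i, X i * pderiv i q) := by simp only [pderiv_sum_X_mul, pderiv_pderiv_comm j]
    _ = p j + ∑ i, X i * pderiv i (p j) := by simp only [hq, pderiv_sum_X_mul, h j]

end Polynomial
section Commutator

attribute [local instance] LieRing.ofAssociativeRing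

variable {A : Type*} [Ring A]

theorem mul_lie (a b y : A) : ⁅a * b, y⁆ = a * ⁅b, y⁆ + ⁅a, y⁆ * b := by
  simp only [Ring.lie_def]
  noncomm_ring

theorem lie_lie_comm {a b : A} (hab : Commute a b) (c : A) : ⁅⁅c, a⁆, b⁆ = ⁅⁅c, b⁆, a⁆ := by
  rw [lie_lie c, hab.lie_eq, lie_zero, zero_sub, lie_skew]

theorem pow_lie_of_lie_eq_one {a y : A} (h : ⁅a, y⁆ = 1) (k : ℕ) :
    ⁅a ^ k, y⁆ = k • a ^ (k - 1) := by
  induction k with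
  | zero => simp [Ring.lie_def]
  | succ k ih =>
    rw [pow_succ', mul_lie, ih, h, one_mul, mul_smul_comm, Nat.add_sub_cancel, succ_nsmul]
    cases k with
    | zero => simp
    | succ k => rw [Nat.add_sub_cancel, ← pow_succ']

theorem prod_ofFn_pow_lie {n : ℕ} {f : Fin n → A} {y : A} {i : Fin n}
    (h : ∀ j, ⁅f j, y⁆ = (Pi.single i 1 : Fin n → A) j) (α : Fin n → ℕ) :
    ⁅(List.ofFn fun j => f j ^ α j).prod, y⁆ =
      α i • (List.ofFn fun j => f j ^ (α j - (Pi.single i 1 : Fin n → ℕ) j)).prod := by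
  induction n with
  | zero => exact i.elim0
  | succ n ih =>
    simp only [List.ofFn_succ, List.prod_cons, mul_lie]
    cases i using Fin.cases with
    | zero =>
      have htail : Commute (List.ofFn fun j : Fin n => f j.succ ^ α j.succ).prod y := by
        refine Commute.list_prod_left _ _ fun a ha => ?_
        obtain ⟨j, rfl⟩ := List.mem_ofFn.mp ha
        exact (commute_iff_lie_eq.mpr (by simpa using h j.succ)).pow_left _
      rw [htail.lie_eq, pow_lie_of_lie_eq_one (by simpa using h 0), smul_mul_assoc]
      simp
    | succ i =>
      have hhead : Commute (f 0 ^ α 0) y :=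
        (commute_iff_lie_eq.mpr (by simpa using h 0)).pow_left _
      have htail := ih (f := fun j => f j.succ) (i := i)
        (fun j => by simpa [Pi.single_apply] using h j.succ) fun j => α j.succ
      rw [hhead.lie_eq, htail, mul_smul_comm]
      simp [Pi.single_apply]

end Commutator
/-- Derivations `d i` and elements `x i` of a commutative `K`-algebra `R` form a coordinate system
if they are dual to each other and a `K`-derivation of `R` is determined by its values at the
`x i`: the abstract form of the partial derivatives of a ring of polynomials or power series. -/
structure IsCoordinateSystem {K R ι : Type*} [CommRing K] [CommRing R] [Algebra K R]
    [DecidableEq ι] (d : ι → Derivation K R R) (x : ι → R) : Prop where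
  apply_eq_single (i j : ι) : d i (x j) = (Pi.single i 1 : ι → R) j
  eq_zero_of_forall_apply_eq_zero (δ : Derivation K R R) : (∀ i, δ (x i) = 0) → δ = 0

namespace IsDiffOp

variable {K R : Type*} [CommRing K] [CommRing R] [Algebra K R]

theorem eq_mulLeft {P : Module.End K R} (hP : IsDiffOp K R 0 P) :
    P = LinearMap.mulLeft K (P 1) := by
  ext a
  have h := LinearMap.congr_fun (hP a) 1
  simp only [LinearMap.sub_apply, Module.End.mul_apply, LinearMap.mulLeft_apply, mul_one,
    LinearMap.zero_apply, sub_eq_zero] at h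
  rw [h, LinearMap.mulLeft_apply, mul_comm]

theorem derivation_lie_mulLeft (δ : Derivation K R R) (a : R) :
    ⁅(δ : Module.End K R), LinearMap.mulLeft K a⁆ = LinearMap.mulLeft K (δ a) := by
  ext f
  simp [Ring.lie_def, mul_comm]

theorem derivation (δ : Derivation K R R) : IsDiffOp K R 1 (δ : Module.End K R) := fun a => by
  rw [← Ring.lie_def, derivation_lie_mulLeft]
  exact IsDiffOp.mulLeft (δ a)

theorem commute_mulLeft (a b : R) : Commute (LinearMap.mulLeft K a) (LinearMap.mulLeft K b) :=
  LinearMap.ext (mul_left_comm a b)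

theorem eq_mulLeft_of_forall_commute {ι : Type*} {x : ι → R}
    (hx : ∀ δ : Derivation K R R, (∀ i, δ (x i) = 0) → δ = 0) {m : ℕ} {P : Module.End K R}
    (hP : IsDiffOp K R m P) (hcomm : ∀ i, Commute P (LinearMap.mulLeft K (x i))) :
    P = LinearMap.mulLeft K (P 1) := by
  induction m generalizing P with
  | zero => exact hP.eq_mulLeft
  | succ m ih =>
    have hlie (a : R) := ih (hP a) fun i =>
      ((hcomm i).mul_left (commute_mulLeft a (x i))).sub_left
        ((commute_mulLeft a (x i)).mul_left (hcomm i))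
    have hmul (a b : R) : P (a * b) = a * P b + b * (P a - a * P 1) := by
      have h := LinearMap.congr_fun (hlie a) b
      simp only [LinearMap.sub_apply, Module.End.mul_apply, LinearMap.mulLeft_apply,
        mul_one] at h
      linear_combination h
    let δ : Derivation K R R := Derivation.mk' (P - LinearMap.mulLeft K (P 1)) fun a b => by
      simp only [LinearMap.sub_apply, LinearMap.mulLeft_apply, smul_eq_mul, hmul]
      ring
    have hδ : δ = 0 := hx δ fun i => by
      have h := LinearMap.congr_fun (hcomm i) 1
      simp only [Module.End.mul_apply, LinearMap.mulLeft_apply, mul_one] at h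
      simp [δ, h, mul_comm]
    exact sub_eq_zero.mp (congrArg (fun δ : Derivation K R R => (δ : R →ₗ[K] R)) hδ)

end IsDiffOp

namespace DiffOp

open MulOpposite MvPolynomial

attribute [local instance] LieRing.ofAssociativeRing

variable {K R : Type*} [CommRing K] [CommRing R] [Algebra K R]

theorem toEnd_injective : Function.Injective (toEnd K R) := Subtype.val_injective

theorem ofRing_injective : Function.Injective (ofRing K R) := fun r s h => by
  simpa only [toEnd_ofRing, mul_one] using LinearMap.congr_fun (congrArg (toEnd K R) h) 1

theorem ofRing_commute (a b : R) : Commute (ofRing K R a) (ofRing K R b) :=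
  (Commute.all a b).map (ofRing K R)

theorem toEnd_lie_ofRing (P : DiffOp K R) (a : R) :
    toEnd K R ⁅P, ofRing K R a⁆ = ⁅toEnd K R P, LinearMap.mulLeft K a⁆ := rfl

theorem eq_ofRing_of_forall_lie_eq_zero {ι : Type*} {x : ι → R}
    (hx : ∀ δ : Derivation K R R, (∀ i, δ (x i) = 0) → δ = 0) {P : DiffOp K R}
    (hP : ∀ i, ⁅P, ofRing K R (x i)⁆ = 0) : P = ofRing K R (toEnd K R P 1) := by
  obtain ⟨m, hm⟩ := P.2
  exact toEnd_injective <| IsDiffOp.eq_mulLeft_of_forall_commute hx hm fun i =>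
    (commute_iff_lie_eq.mpr (hP i)).map (toEnd K R)

theorem smul_lie_ofRing (r : Rᵐᵒᵖ) (P : DiffOp K R) (a : R) :
    ⁅r • P, ofRing K R a⁆ = r • ⁅P, ofRing K R a⁆ := by
  induction r with | _ r
  rw [op_smul_eq_mul, op_smul_eq_mul, mul_lie, (ofRing_commute r a).lie_eq, mul_zero, zero_add]

variable {n : ℕ} (d : Fin n → Derivation K R R) {x : Fin n → R}

/-- The operator `∂^α` as an element of the ring of differential operators. -/
noncomputable def derivOp (α : Fin n →₀ ℕ) : DiffOp K R :=
  ⟨derivMonomial d α, list_prod_mem <| List.forall_mem_ofFn_iff.mpr fun i =>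
    pow_mem (show (d i : Module.End K R) ∈ diffOpSubalgebra K R from ⟨1, .derivation (d i)⟩) _⟩

theorem toEnd_derivOp (α : Fin n →₀ ℕ) : toEnd K R (derivOp d α) = derivMonomial d α := rfl

theorem derivOp_zero : derivOp d 0 = 1 := toEnd_injective <| by
  simp [toEnd_derivOp, derivMonomial]

/-- The operator `∑ ∂^α ψ_α` with symbol `∑ ψ_α ξ^α`. Symbols have coefficients in `Rᵐᵒᵖ` because
the `ψ_α` stand to the right of the derivatives. -/
noncomputable def ofSymbol : MvPolynomial (Fin n) Rᵐᵒᵖ →ₗ[Rᵐᵒᵖ] DiffOp K R :=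
  (basisMonomials (Fin n) Rᵐᵒᵖ).constr Rᵐᵒᵖ (derivOp d)

theorem ofSymbol_monomial (α : Fin n →₀ ℕ) (r : Rᵐᵒᵖ) :
    ofSymbol d (monomial α r) = r • derivOp d α := by
  have h : monomial α r = r • basisMonomials (Fin n) Rᵐᵒᵖ α := by
    simp [smul_monomial]
  rw [h, map_smul, ofSymbol, Module.Basis.constr_basis]

theorem ofSymbol_C (r : R) : ofSymbol d (C (op r)) = ofRing K R r := by
  rw [C_apply, ofSymbol_monomial, derivOp_zero, op_smul_eq_mul, one_mul]

variable {d}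

theorem derivOp_lie_ofRing (hd : ∀ i j, d i (x j) = (Pi.single i 1 : Fin n → R) j)
    (α : Fin n →₀ ℕ) (i : Fin n) :
    ⁅derivOp d α, ofRing K R (x i)⁆ = α i • derivOp d (α - Finsupp.single i 1) := by
  have hlie (j : Fin n) : ⁅(d j : Module.End K R), LinearMap.mulLeft K (x i)⁆ =
      (Pi.single i 1 : Fin n → Module.End K R) j := by
    rw [IsDiffOp.derivation_lie_mulLeft, hd, Pi.single_apply, Pi.single_apply]
    by_cases hij : i = j
    · rw [if_pos hij, if_pos hij.symm, LinearMap.mulLeft_one, Module.End.one_eq_id]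
    · rw [if_neg hij, if_neg (Ne.symm hij), LinearMap.mulLeft_zero_eq_zero]
  apply toEnd_injective
  rw [map_nsmul, toEnd_lie_ofRing, toEnd_derivOp, toEnd_derivOp, derivMonomial,
    prod_ofFn_pow_lie hlie, derivMonomial, ← Finsupp.single_eq_pi_single]
  rfl

theorem ofSymbol_pderiv (hd : ∀ i j, d i (x j) = (Pi.single i 1 : Fin n → R) j) (i : Fin n)
    (p : MvPolynomial (Fin n) Rᵐᵒᵖ) :
    ofSymbol d (pderiv i p) = ⁅ofSymbol d p, ofRing K R (x i)⁆ := by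
  induction p using MvPolynomial.induction_on' with
  | add p q hp hq => simp only [map_add, hp, hq, add_lie]
  | monomial α r =>
    rw [pderiv_monomial, ofSymbol_monomial, ofSymbol_monomial, smul_lie_ofRing,
      derivOp_lie_ofRing hd, mul_smul, Nat.cast_smul_eq_nsmul]

theorem ofSymbol_injective [IsAddTorsionFree Rᵐᵒᵖ]
    (hd : ∀ i j, d i (x j) = (Pi.single i 1 : Fin n → R) j) :
    Function.Injective (ofSymbol d) := by
  refine (injective_iff_map_eq_zero _).mpr fun p hp => ?_
  refine eq_zero_of_mem_of_pderiv_mem (S := {p | ofSymbol d p = 0}) (fun q hq i => ?_)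
    (fun r hr => ?_) hp
  · rw [Set.mem_ofPred_eq, ofSymbol_pderiv hd, hq, zero_lie]
  · rw [Set.mem_ofPred_eq, ← op_unop r, ofSymbol_C] at hr
    exact (unop_eq_zero_iff r).mp ((map_eq_zero_iff _ ofRing_injective).mp hr)

theorem ofSymbol_surjective [Algebra ℚ R] (h : IsCoordinateSystem d x) :
    Function.Surjective (ofSymbol d) := by
  suffices hord : ∀ (m : ℕ) (P : DiffOp K R), IsDiffOp K R m (toEnd K R P) →
      ∃ p, ofSymbol d p = P from fun P => P.2.elim fun m hm => hord m P hm
  intro m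
  induction m with
  | zero =>
    exact fun P hP => ⟨C (op (toEnd K R P 1)), (ofSymbol_C d _).trans <|
      toEnd_injective hP.eq_mulLeft.symm⟩
  | succ m ih =>
    intro P hP
    choose p hp using fun i => ih ⁅P, ofRing K R (x i)⁆ (hP (x i))
    have hclosed (i j : Fin n) : pderiv i (p j) = pderiv j (p i) := by
      have : IsAddTorsionFree Rᵐᵒᵖ := .of_module_rat Rᵐᵒᵖ
      apply ofSymbol_injective h.apply_eq_single
      rw [ofSymbol_pderiv h.apply_eq_single, ofSymbol_pderiv h.apply_eq_single, hp, hp,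
        lie_lie_comm (ofRing_commute _ _)]
    obtain ⟨q, hq⟩ := exists_forall_pderiv_eq hclosed
    have hsub : P - ofSymbol d q = ofRing K R (toEnd K R (P - ofSymbol d q) 1) :=
      eq_ofRing_of_forall_lie_eq_zero h.eq_zero_of_forall_apply_eq_zero fun i => by
        rw [sub_lie, ← ofSymbol_pderiv h.apply_eq_single, hq, hp, sub_self]
    refine ⟨C (op (toEnd K R (P - ofSymbol d q) 1)) + q, ?_⟩
    rw [map_add, ofSymbol_C, ← hsub, sub_add_cancel]

theorem ofSymbol_bijective [Algebra ℚ R] (h : IsCoordinateSystem d x) :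
    Function.Bijective (ofSymbol d) :=
  have : IsAddTorsionFree Rᵐᵒᵖ := .of_module_rat Rᵐᵒᵖ
  ⟨ofSymbol_injective h.apply_eq_single, ofSymbol_surjective h⟩

/-- The basis of the right `R`-module of differential operators formed by the `∂^α`. -/
noncomputable def derivOpBasis [Algebra ℚ R] (h : IsCoordinateSystem d x) :
    Module.Basis (Fin n →₀ ℕ) Rᵐᵒᵖ (DiffOp K R) :=
  (basisMonomials (Fin n) Rᵐᵒᵖ).map (.ofBijective (ofSymbol d) (ofSymbol_bijective h))

theorem derivOpBasis_apply [Algebra ℚ R] (h : IsCoordinateSystem d x) (α : Fin n →₀ ℕ) :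
    derivOpBasis h α = derivOp d α := by
  rw [derivOpBasis, Module.Basis.map_apply, coe_basisMonomials, LinearEquiv.ofBijective_apply,
    ofSymbol_monomial, one_smul]

end DiffOp
section InjectiveDescent

open TensorProduct

variable {R D X E : Type*} [CommRing R] [Ring D] [Module R D] [SMulCommClass R D D]
  [AddCommGroup X] [Module R X] [AddCommGroup E] [Module D E]

/-- The `D`-linear map `D ⊗[R] X → E`, `P ⊗ x ↦ P • g x`, for a ring `D` with an `R`-module
structure by right multiplications, such as the one given by a ring homomorphism `R → D` with
non-central image. -/
noncomputable def tensorSMulLift (g : X →+ E) (hg : ∀ (r : R) x, g (r • x) = (r • (1 : D)) • g x) :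
    D ⊗[R] X →ₗ[D] E :=
  let G : D ⊗[R] X →+ E := liftAddHom ((smulAddHom D E).compl₂ g) fun r P x => by
    simp [hg, ← mul_smul]
  have hG (P : D) (x : X) : G (P ⊗ₜ x) = P • g x := rfl
  { G with
    map_smul' := fun P t => by
      induction t with
      | zero => simp
      | tmul Q x => simp [hG, smul_tmul', mul_smul]
      | add s t hs ht => simp_all [smul_add] }

theorem tensorSMulLift_tmul (g : X →+ E) (hg : ∀ (r : R) x, g (r • x) = (r • (1 : D)) • g x)
    (P : D) (x : X) : tensorSMulLift g hg (P ⊗ₜ x) = P • g x := rfl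

theorem one_tmul_smul (r : R) (x : X) :
    (1 : D) ⊗ₜ[R] (r • x) = (r • (1 : D)) • (1 : D) ⊗ₜ[R] x := by
  rw [smul_tmul', smul_eq_mul, mul_one, smul_tmul]

variable (D) in
theorem exists_linearMap_eq_lTensor {Y : Type*} [AddCommGroup Y] [Module R Y] (f : X →ₗ[R] Y) :
    ∃ F : D ⊗[R] X →ₗ[D] D ⊗[R] Y, ⇑F = f.lTensor D := by
  refine ⟨tensorSMulLift ((TensorProduct.mk R D Y 1).comp f : X →ₗ[R] D ⊗[R] Y).toAddMonoidHom
    fun r x => by simpa using one_tmul_smul (D := D) r (f x), funext fun t => ?_⟩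
  induction t with
  | zero => simp
  | tmul P x => simp [tensorSMulLift_tmul, smul_tmul']
  | add s t hs ht => rw [map_add, map_add, hs, ht]

theorem injective_of_flat {E : Type v} [Small.{v} D] [AddCommGroup E] [Module D E] [Module R E]
    [Module.Flat R D] [Module.Injective D E]
    (hE : ∀ (r : R) (e : E), r • e = (r • (1 : D)) • e) : Module.Injective R E where
  out X Y _ _ _ _ f hf g := by
    obtain ⟨F, hF⟩ := exists_linearMap_eq_lTensor D f
    obtain ⟨H, hH⟩ := Module.Injective.extension_property D E _ _ F
      (hF ▸ Module.Flat.lTensor_preserves_injective_linearMap f hf)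
      (tensorSMulLift g.toAddMonoidHom fun r x => by simp [hE])
    refine ⟨{ toFun := fun y => H (1 ⊗ₜ y)
              map_add' := fun y z => by rw [tmul_add, map_add]
              map_smul' := fun r y => by rw [one_tmul_smul, map_smul, RingHom.id_apply, hE] },
      fun x => ?_⟩
    calc H (1 ⊗ₜ f x)
      _ = H (F (1 ⊗ₜ x)) := by rw [hF, LinearMap.lTensor_tmul]
      _ = (1 : D) • g x := LinearMap.congr_fun hH _
      _ = g x := one_smul D (g x)

end InjectiveDescent

theorem DiffOp.injective_of_free {K R : Type*} [CommRing K] [CommRing R] [Algebra K R]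
    [Module.Free Rᵐᵒᵖ (DiffOp K R)] {E : Type v} [Small.{v} (DiffOp K R)] [AddCommGroup E]
    [Module (DiffOp K R) E] [Module R E] (hE : ∀ (r : R) (e : E), r • e = ofRing K R r • e)
    [Module.Injective (DiffOp K R) E] : Module.Injective R E := by
  let : Module R (DiffOp K R) := Module.compHom _ (RingEquiv.toOpposite R).toRingHom
  have hsmul (r : R) (P : DiffOp K R) : r • P = P * ofRing K R r := rfl
  have : SMulCommClass R (DiffOp K R) (DiffOp K R) := ⟨fun r P Q => mul_assoc P Q _⟩
  have : Module.Free R (DiffOp K R) := .of_basis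
    ((Module.Free.chooseBasis Rᵐᵒᵖ (DiffOp K R)).mapCoeffs (RingEquiv.toOpposite R).symm
      fun _ _ => rfl)
  exact injective_of_flat fun r e => by rw [hE, hsmul, one_mul]
section Coordinates

theorem derivation_eq_zero_of_isHausdorff {K R M ι : Type*} [CommRing K] [CommRing R] [Algebra K R]
    [AddCommGroup M] [Module K M] [Module R M] {x : ι → R}
    [IsHausdorff (Ideal.span (Set.range x)) M]
    (hx : ∀ f : R, ∃ c : K, f - algebraMap K R c ∈ Ideal.span (Set.range x))
    {δ : Derivation K R M} (hδ : ∀ i, δ (x i) = 0) : δ = 0 := by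
  set I := Ideal.span (Set.range x)
  suffices hpow : ∀ (k : ℕ) (f : R), δ f ∈ (I ^ k • ⊤ : Submodule R M) from
    Derivation.ext fun f => IsHausdorff.haus ‹_› _ fun k => SModEq.zero.mpr (hpow k f)
  intro k
  induction k with
  | zero => simp
  | succ k ih =>
    have hI (g : R) (hg : g ∈ I) : δ g ∈ (I ^ (k + 1) • ⊤ : Submodule R M) := by
      induction hg using Submodule.span_induction with
      | mem g hg =>
        obtain ⟨i, rfl⟩ := hg
        exact hδ i ▸ zero_mem _
      | zero => exact map_zero δ ▸ zero_mem _
      | add g h _ _ hg hh => exact map_add δ g h ▸ add_mem hg hh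
      | smul a g hg hδg =>
        rw [smul_eq_mul, δ.leibniz, pow_succ', mul_smul]
        exact add_mem (Submodule.smul_mem _ a (by rwa [← mul_smul, ← pow_succ']))
          (Submodule.smul_mem_smul hg (ih a))
    intro f
    obtain ⟨c, hc⟩ := hx f
    simpa using hI _ hc

theorem map_derivMonomial {K A B : Type*} [CommRing K] [CommRing A] [Algebra K A] [CommRing B]
    [Algebra K B] {n : ℕ} {d : Fin n → Derivation K A A} {d' : Fin n → Derivation K B B}
    (φ : A →ₗ[K] B) (h : ∀ i f, φ (d i f) = d' i (φ f)) (α : Fin n →₀ ℕ) (f : A) :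
    φ (derivMonomial d α f) = derivMonomial d' α (φ f) := by
  have hpow (i : Fin n) (k : ℕ) (f : A) :
      φ (((d i : Module.End K A) ^ k) f) = ((d' i : Module.End K B) ^ k) (φ f) :=
    (LinearMap.congr_fun (Module.End.commute_pow_left_of_commute
      (LinearMap.ext fun f => (h i f).symm) k) f).symm
  simp only [derivMonomial, List.ofFn_eq_map]
  induction List.finRange n with
  | nil => rfl
  | cons i l ih => simp only [List.map_cons, List.prod_cons, Module.End.mul_apply, hpow, ih]

theorem IsCoordinateSystem.mvPolynomial (σ K : Type*) [DecidableEq σ] [CommRing K] :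
    IsCoordinateSystem (K := K) MvPolynomial.pderiv (MvPolynomial.X : σ → MvPolynomial σ K) where
  apply_eq_single i j := MvPolynomial.pderiv_X i j
  eq_zero_of_forall_apply_eq_zero _ hδ := MvPolynomial.derivation_ext hδ

end Coordinates

section PowerSeries

open MvPowerSeries

variable {σ K : Type*}

/-- The coefficients `gᵢ` of a Hadamard decomposition `f = f(0) + ∑ xᵢ gᵢ`: formally
`gᵢ = ∫₀¹ (∂ᵢ f)(t x) dt`. -/
noncomputable def hadamardQuotient [AddCommGroup K] [Module ℚ K] (i : σ) (f : MvPowerSeries σ K) :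
    MvPowerSeries σ K :=
  fun α => ((α i + 1 : ℕ) / (α.degree + 1 : ℕ) : ℚ) • f (α + Finsupp.single i 1)

variable [CommRing K] [Algebra ℚ K]

theorem coeff_hadamardQuotient (i : σ) (f : MvPowerSeries σ K) (α : σ →₀ ℕ) :
    coeff α (hadamardQuotient i f) =
      ((α i + 1 : ℕ) / (α.degree + 1 : ℕ) : ℚ) • coeff (α + Finsupp.single i 1) f := rfl

theorem coeff_X_mul_hadamardQuotient (i : σ) (f : MvPowerSeries σ K) (α : σ →₀ ℕ) :
    coeff α (X i * hadamardQuotient i f) = (α i / α.degree : ℚ) • coeff α f := by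
  classical
  rw [X_def, coeff_monomial_mul, one_mul]
  split_ifs with hi
  · obtain ⟨β, rfl⟩ := exists_add_of_le hi
    rw [add_tsub_cancel_left, coeff_hadamardQuotient]
    simp [add_comm]
  · simp_all

theorem eq_C_add_sum_X_mul_hadamardQuotient [Fintype σ] (f : MvPowerSeries σ K) :
    f = C (constantCoeff f) + ∑ i, X i * hadamardQuotient i f := by
  classical
  ext α
  simp only [map_add, map_sum, coeff_X_mul_hadamardQuotient, ← Finset.sum_smul, ← Finset.sum_div,
    coeff_C, ← Nat.cast_sum, ← Finsupp.degree_eq_sum]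
  split_ifs with hα
  · simp [hα]
  · have hdeg : (α.degree : ℚ) ≠ 0 :=
      Nat.cast_ne_zero.mpr ((Finsupp.degree_eq_zero_iff α).not.mpr hα)
    rw [div_self hdeg, one_smul, zero_add]

variable (σ K) in
theorem IsCoordinateSystem.mvPowerSeries [Finite σ] [DecidableEq σ] :
    IsCoordinateSystem (MvPowerSeries.pderiv K) (X : σ → MvPowerSeries σ K) where
  apply_eq_single i j := pderiv_X i j
  eq_zero_of_forall_apply_eq_zero _ := derivation_eq_zero_of_isHausdorff fun f => by
    cases nonempty_fintype σ
    refine ⟨constantCoeff f, ?_⟩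
    nth_rw 1 [eq_C_add_sum_X_mul_hadamardQuotient f]
    rw [MvPowerSeries.algebraMap_apply, Algebra.algebraMap_self_apply, add_sub_cancel_left]
    exact sum_mem fun i _ => Ideal.mul_mem_right _ _ (Ideal.subset_span ⟨i, rfl⟩)

end PowerSeries

namespace IsConvergentSeries

variable {n : ℕ} {f g : MvPowerSeries (Fin n) ℂ}

theorem of_norm_coeff_le {c : ℝ} (hc : 0 < c) (β : Fin n →₀ ℕ) (hf : IsConvergentSeries f)
    (h : ∀ α : Fin n →₀ ℕ, ‖MvPowerSeries.coeff α g‖ ≤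
      c ^ α.degree * ‖MvPowerSeries.coeff (α + β) f‖) :
    IsConvergentSeries g := by
  obtain ⟨r, hr, hf⟩ := hf
  refine ⟨r / c, by positivity, .of_nonneg_of_le (fun α => by positivity) (fun α => ?_)
    ((hf.comp_injective (add_left_injective β)).mul_left (r ^ β.degree)⁻¹)⟩
  calc ‖MvPowerSeries.coeff α g‖ * (r / c) ^ α.degree
    _ ≤ c ^ α.degree * ‖MvPowerSeries.coeff (α + β) f‖ * (r / c) ^ α.degree := by
      gcongr
      exact h α
    _ = (r ^ β.degree)⁻¹ * (‖MvPowerSeries.coeff (α + β) f‖ * r ^ (α + β).degree) := by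
      rw [map_add, pow_add, div_pow]
      field_simp

theorem X (i : Fin n) : IsConvergentSeries (MvPowerSeries.X i) := by
  classical
  refine ⟨1, one_pos, summable_of_ne_finset_zero (s := {Finsupp.single i 1}) fun α hα => ?_⟩
  rw [MvPowerSeries.coeff_X, if_neg (by simpa using hα), norm_zero, zero_mul]

theorem pderiv (hf : IsConvergentSeries f) (i : Fin n) :
    IsConvergentSeries (MvPowerSeries.pderiv ℂ i f) := by
  refine hf.of_norm_coeff_le two_pos (.single i 1) fun α => ?_
  rw [MvPowerSeries.coeff_pderiv, norm_mul, mul_comm, ← Nat.cast_succ, Complex.norm_natCast]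
  gcongr
  exact_mod_cast (Nat.succ_le_succ (Finsupp.le_degree i α)).trans α.degree.lt_two_pow_self

theorem hadamardQuotient (hf : IsConvergentSeries f) (i : Fin n) :
    IsConvergentSeries (hadamardQuotient i f) := by
  refine hf.of_norm_coeff_le one_pos (.single i 1) fun α => ?_
  rw [coeff_hadamardQuotient, one_pow, norm_smul]
  gcongr
  rw [← Rat.norm_cast_real]
  push_cast
  rw [Real.norm_of_nonneg (by positivity), div_le_one (by positivity)]
  gcongr
  exact Finsupp.le_degree i α

end IsConvergentSeries

namespace convergentPowerSeries

variable {n : ℕ}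

/-- The coordinate function `zᵢ` as a convergent power series. -/
noncomputable def X (i : Fin n) : convergentPowerSeries n :=
  ⟨MvPowerSeries.X i, .X i⟩

/-- The partial derivative `∂ᵢ` of convergent power series. -/
noncomputable def pderiv (i : Fin n) :
    Derivation ℂ (convergentPowerSeries n) (convergentPowerSeries n) :=
  .mk' ((MvPowerSeries.pderiv ℂ i : MvPowerSeries (Fin n) ℂ →ₗ[ℂ] MvPowerSeries (Fin n) ℂ).restrict
      (p := (convergentPowerSeries n).toSubmodule) (q := (convergentPowerSeries n).toSubmodule)
      fun _ hf => IsConvergentSeries.pderiv hf i)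
    fun f g => Subtype.ext ((MvPowerSeries.pderiv ℂ i).leibniz f.1 g.1)

theorem coe_derivMonomial_pderiv (α : Fin n →₀ ℕ) (f : convergentPowerSeries n) :
    (derivMonomial pderiv α f : MvPowerSeries (Fin n) ℂ) =
      derivMonomial (MvPowerSeries.pderiv ℂ) α (f : MvPowerSeries (Fin n) ℂ) :=
  map_derivMonomial (convergentPowerSeries n).val.toLinearMap (fun _ _ => rfl) α f

theorem pderiv_X (i j : Fin n) :
    pderiv i (X j) = (Pi.single i 1 : Fin n → convergentPowerSeries n) j := by
  apply Subtype.ext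
  change MvPowerSeries.pderiv ℂ i (MvPowerSeries.X j) = _
  rw [MvPowerSeries.pderiv_X, Pi.single_apply, Pi.single_apply]
  split_ifs <;> rfl

theorem exists_sub_algebraMap_mem_span_X (f : convergentPowerSeries n) :
    ∃ c : ℂ, f - algebraMap ℂ (convergentPowerSeries n) c ∈ Ideal.span (Set.range X) := by
  let g (i : Fin n) : convergentPowerSeries n := ⟨_, f.2.hadamardQuotient i⟩
  have hf : f = algebraMap ℂ _ (MvPowerSeries.constantCoeff f.1) + ∑ i, X i * g i := by
    apply Subtype.ext
    push_cast
    exact eq_C_add_sum_X_mul_hadamardQuotient f.1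
  refine ⟨MvPowerSeries.constantCoeff f.1, ?_⟩
  rw [sub_eq_of_eq_add' hf]
  exact sum_mem fun i _ => Ideal.mul_mem_right _ _ (Ideal.subset_span ⟨i, rfl⟩)

instance : IsHausdorff (Ideal.span (Set.range X) : Ideal (convergentPowerSeries n))
    (MvPowerSeries (Fin n) ℂ) :=
  .of_map (J := (Ideal.span (Set.range MvPowerSeries.X) : Ideal (MvPowerSeries (Fin n) ℂ))) <| by
    rw [Ideal.map_span, ← Set.range_comp]
    rfl

theorem isCoordinateSystem : IsCoordinateSystem (pderiv (n := n)) X where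
  apply_eq_single := pderiv_X
  eq_zero_of_forall_apply_eq_zero δ hδ := by
    let ι : convergentPowerSeries n →ₗ[convergentPowerSeries n] MvPowerSeries (Fin n) ℂ :=
      (IsScalarTower.toAlgHom _ _ _).toLinearMap
    have hι : ι.compDer δ = 0 :=
      derivation_eq_zero_of_isHausdorff exists_sub_algebraMap_mem_span_X fun i =>
        congrArg Subtype.val (hδ i)
    exact Derivation.ext fun f => Subtype.ext (Derivation.congr_fun hι f)

end convergentPowerSeries

theorem mainTheorem7_general {K R : Type*} [CommRing K] [CommRing R] [Algebra K R] [Algebra ℚ R]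
    {n : ℕ} {d : Fin n → Derivation K R R} {x : Fin n → R} (h : IsCoordinateSystem d x) :
    Module.Free Rᵐᵒᵖ (DiffOp K R) ∧
    (∃ b : Module.Basis (Fin n →₀ ℕ) Rᵐᵒᵖ (DiffOp K R),
      ∀ (α : Fin n →₀ ℕ) (f : R), DiffOp.toEnd K R (b α) f = derivMonomial d α f) ∧
    ∀ (E : Type v) [Small.{v} (DiffOp K R)] [AddCommGroup E] [Module (DiffOp K R) E] [Module R E],
      (∀ (r : R) (e : E), r • e = DiffOp.ofRing K R r • e) →
      Module.Injective (DiffOp K R) E → Module.Injective R E :=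
  have hfree : Module.Free Rᵐᵒᵖ (DiffOp K R) := .of_basis (DiffOp.derivOpBasis h)
  ⟨hfree,
    ⟨DiffOp.derivOpBasis h,
      fun α f => by rw [DiffOp.derivOpBasis_apply, DiffOp.toEnd_derivOp]⟩,
    fun _ _ _ _ _ hE _ => DiffOp.injective_of_free hE⟩

theorem mainTheorem7 (n : ℕ) :
    -- `R = K[X₁, …, Xₙ]`
    (∀ (K : Type u) [Field K] [CharZero K],
      Module.Free (MvPolynomial (Fin n) K)ᵐᵒᵖ (DiffOp K (MvPolynomial (Fin n) K)) ∧
      (∃ b : Module.Basis (Fin n →₀ ℕ) (MvPolynomial (Fin n) K)ᵐᵒᵖ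
          (DiffOp K (MvPolynomial (Fin n) K)),
        ∀ (α : Fin n →₀ ℕ) (f : MvPolynomial (Fin n) K),
          DiffOp.toEnd K (MvPolynomial (Fin n) K) (b α) f =
            derivMonomial (fun i => MvPolynomial.pderiv i) α f) ∧
      ∀ (E : Type (max u v)) [AddCommGroup E] [Module (DiffOp K (MvPolynomial (Fin n) K)) E]
        [Module (MvPolynomial (Fin n) K) E],
        (∀ (r : MvPolynomial (Fin n) K) (e : E),
          r • e = DiffOp.ofRing K (MvPolynomial (Fin n) K) r • e) →
        Module.Injective (DiffOp K (MvPolynomial (Fin n) K)) E →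
        Module.Injective (MvPolynomial (Fin n) K) E) ∧
    -- `R = K[[X₁, …, Xₙ]]`
    (∀ (K : Type u) [Field K] [CharZero K],
      Module.Free (MvPowerSeries (Fin n) K)ᵐᵒᵖ (DiffOp K (MvPowerSeries (Fin n) K)) ∧
      (∃ b : Module.Basis (Fin n →₀ ℕ) (MvPowerSeries (Fin n) K)ᵐᵒᵖ
          (DiffOp K (MvPowerSeries (Fin n) K)),
        ∀ (α : Fin n →₀ ℕ) (f : MvPowerSeries (Fin n) K),
          DiffOp.toEnd K (MvPowerSeries (Fin n) K) (b α) f =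
            derivMonomial (fun i => MvPowerSeries.pderiv K i) α f) ∧
      ∀ (E : Type (max u v)) [AddCommGroup E] [Module (DiffOp K (MvPowerSeries (Fin n) K)) E]
        [Module (MvPowerSeries (Fin n) K) E],
        (∀ (r : MvPowerSeries (Fin n) K) (e : E),
          r • e = DiffOp.ofRing K (MvPowerSeries (Fin n) K) r • e) →
        Module.Injective (DiffOp K (MvPowerSeries (Fin n) K)) E →
        Module.Injective (MvPowerSeries (Fin n) K) E) ∧
    -- `R = ℂ{z₁, …, zₙ}`
    (Module.Free (convergentPowerSeries n)ᵐᵒᵖ (DiffOp ℂ (convergentPowerSeries n)) ∧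
      (∃ b : Module.Basis (Fin n →₀ ℕ) (convergentPowerSeries n)ᵐᵒᵖ
          (DiffOp ℂ (convergentPowerSeries n)),
        ∀ (α : Fin n →₀ ℕ) (f : convergentPowerSeries n),
          (DiffOp.toEnd ℂ (convergentPowerSeries n) (b α) f : MvPowerSeries (Fin n) ℂ) =
            derivMonomial (fun i => MvPowerSeries.pderiv ℂ i) α
              (f : MvPowerSeries (Fin n) ℂ)) ∧
      ∀ (E : Type v) [AddCommGroup E] [Module (DiffOp ℂ (convergentPowerSeries n)) E]
        [Module (convergentPowerSeries n) E],
        (∀ (r : convergentPowerSeries n) (e : E),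
          r • e = DiffOp.ofRing ℂ (convergentPowerSeries n) r • e) →
        Module.Injective (DiffOp ℂ (convergentPowerSeries n)) E →
        Module.Injective (convergentPowerSeries n) E) := by
  refine ⟨fun K _ _ => ?_, fun K _ _ => ?_, ?_⟩
  · obtain ⟨hfree, hbasis, hinj⟩ :=
      mainTheorem7_general (IsCoordinateSystem.mvPolynomial (Fin n) K)
    exact ⟨hfree, hbasis, fun E => hinj E⟩
  · obtain ⟨hfree, hbasis, hinj⟩ :=
      mainTheorem7_general (IsCoordinateSystem.mvPowerSeries (Fin n) K)
    exact ⟨hfree, hbasis, fun E => hinj E⟩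
  · obtain ⟨hfree, ⟨b, hb⟩, hinj⟩ :=
      mainTheorem7_general (convergentPowerSeries.isCoordinateSystem (n := n))
    exact ⟨hfree, ⟨b, fun α f => by rw [hb, convergentPowerSeries.coe_derivMonomial_pderiv]⟩,
      fun E => hinj E⟩
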